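/- Let $D$ be a random variable with values in $\{0,1,2,\dots\}$, with probability and expectation denoted by $\mathcal P$ and $\mathcal E$. Let $\mathcal{GW}=(V,E)$ be the Galton–Watson tree with root $\mathcal O$ and offspring distribution $D$: every vertex has a number of children distributed as $D$, independently of all others. Let $\mathfrak P$ be its law. For $x\in V$ and real $s$, let $B_s(x)\subset V$ be the set of vertices at graph distance at most $s$ from $x$, and $|B_s(x)|$ its cardinality. Assume that $d_{\min}:=\min\operatorname{supp}(D)\ge 2$, that $2<\mathcal E[D]<\infty$, and that $\mathcal E[\mathrm e^{aD}]<\infty$ for some $a>0$. Put $\vartheta:=\log\mathcal E[D]$. Then for every function $r\mapsto R_r\in\mathbb R$ of the real variable $r>0$ with $\lim_{r\to\infty}R_r/\log r=\infty$, $\mathfrak P$-almost surely, $$\lim_{r\to\infty}\frac1{R_r}\log\Big(\inf_{x\in B_r(\mathcal O)}|B_{R_r}(x)|\Big)=\lim_{r\to\infty}\frac1{R_r}\log\Big(\sup_{x\in B_r(\mathcal O)}|B_{R_r}(x)|\Big)=\vartheta .$$ Here $r\to\infty$ through the real numbers. In other words, almost surely every ball of radius $R_r$ centred in $B_r(\mathcal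 O)$ has volume $\mathrm e^{\vartheta R_r+o(R_r)}$ as $r\to\infty$, uniformly in the centre. -/

import Mathlib

open MeasureTheory Filter Topology

noncomputable section

namespace GaltonWatson

/-- Vertices are coded by Ulam-Harris labels: `[]` is the root and `i :: v` is the `i`-th child of
`v`, children being numbered from `0`. Given the offspring numbers `c v` of all potential
vertices `v`, a label is a vertex of the tree iff each of its letters is an admissible child
number at the corresponding ancestor. -/
def IsVertex (c : List ℕ → ℕ) : List ℕ → Prop
  | [] => True
  | i :: v => i < c v ∧ IsVertex c v

/-- The vertex set `V` of the tree with offspring numbers `c`. -/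
abbrev Vertex (c : List ℕ → ℕ) : Type := {v : List ℕ // IsVertex c v}

/-- The root `𝒪`. -/
def root (c : List ℕ → ℕ) : Vertex c := ⟨[], trivial⟩

/-- The family tree as a simple graph: two vertices are adjacent iff one is a child of the
other. -/
def tree (c : List ℕ → ℕ) : SimpleGraph (Vertex c) where
  Adj x y := (∃ i, y.1 = i :: x.1) ∨ (∃ i, x.1 = i :: y.1)
  symm := ⟨fun _ _ h => h.symm⟩
  loopless := ⟨fun x h => by
    rcases h with ⟨i, h⟩ | ⟨i, h⟩ <;> simpa using congrArg List.length h⟩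

/-- The (closed) ball `B_s(x)` of real radius `s` around `x` in the graph distance. -/
def ball (c : List ℕ → ℕ) (x : Vertex c) (s : ℝ) : Set (Vertex c) :=
  {y | ((tree c).dist x y : ℝ) ≤ s}

/-- The volume `|B_s(x)|`. -/
def vol (c : List ℕ → ℕ) (x : Vertex c) (s : ℝ) : ℕ := (ball c x s).ncard

/-- The law of the Galton-Watson tree with offspring law `ν` (a probability measure): the
offspring numbers of all labels are independent with law `ν`. -/
def law (ν : Measure ℕ) : Measure (List ℕ → ℕ) := Measure.infinitePi fun _ => ν

/-- The least element of the support of the offspring law. -/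
def dMin (ν : Measure ℕ) : ℕ := sInf ν.support

/-- The mean offspring number. -/
def mean (ν : Measure ℕ) : ℝ := ∫ k, (k : ℝ) ∂ν

/-- The volume growth rate `ϑ`, the logarithm of the mean offspring number. -/
def growthRate (ν : Measure ℕ) : ℝ := Real.log (mean ν)

/-- The graph is connected, so that `SimpleGraph.dist` is the genuine graph distance. -/
theorem tree_connected (c : List ℕ → ℕ) : (tree c).Connected := by
  have key : ∀ (v : List ℕ) (hv : IsVertex c v), (tree c).Reachable (root c) ⟨v, hv⟩ := by
    intro v
    induction v with
    | nil => intro _; exact SimpleGraph.Reachable.refl _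
    | cons i v ih =>
      intro hv
      refine (ih hv.2).trans (SimpleGraph.Adj.reachable ?_)
      exact Or.inl ⟨i, rfl⟩
  have : Nonempty (Vertex c) := ⟨root c⟩
  exact ⟨fun x y => (key x.1 x.2).symm.trans (key y.1 y.2)⟩

/-- All balls are finite, so that `vol` and the suprema of `vol` over balls are genuine. -/
theorem ball_finite (c : List ℕ → ℕ) (x : Vertex c) (s : ℝ) : (ball c x s).Finite := by
  have hnb : ∀ y : Vertex c, {z | (tree c).Adj y z}.Finite := by
    intro y
    refine Set.Finite.of_finite_image (f := Subtype.val) ?_ Subtype.val_injective.injOn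
    refine (((Set.finite_lt_nat (c y.1)).image (fun i => i :: y.1)).union
      (Set.finite_singleton y.1.tail)).subset ?_
    rintro _ ⟨z, hz, rfl⟩
    rcases hz with ⟨i, hi⟩ | ⟨i, hi⟩
    · left
      refine ⟨i, ?_, hi.symm⟩
      have h2 := z.2
      rw [hi] at h2
      exact h2.1
    · right
      simp [hi]
  have hn : ∀ n : ℕ, {y | (tree c).dist x y ≤ n}.Finite := by
    intro n
    induction n with
    | zero =>
      refine (Set.finite_singleton x).subset ?_
      intro y hy
      have h0 : (tree c).dist x y = 0 := Nat.le_zero.mp hy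
      exact ((tree_connected c).dist_eq_zero_iff.mp h0).symm
    | succ n ih =>
      refine (ih.union (ih.biUnion fun y _ => hnb y)).subset ?_
      intro y hy
      rcases Nat.lt_or_ge n ((tree c).dist x y) with h | h
      · right
        obtain ⟨p, hp⟩ := (tree_connected c).exists_walk_length_eq_dist y x
        cases p with
        | nil => simp at h
        | cons hadj q =>
          rename_i w
          refine Set.mem_biUnion (x := w) ?_ hadj.symm
          have h1 := SimpleGraph.dist_le q
          rw [SimpleGraph.Walk.length_cons, SimpleGraph.dist_comm] at hp
          rw [SimpleGraph.dist_comm] at h1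
          have h3 : (tree c).dist x y ≤ n + 1 := hy
          change (tree c).dist x w ≤ n
          omega
      · exact Or.inl h
  exact (hn ⌊s⌋₊).subset fun y hy => Nat.le_floor hy

end GaltonWatson

end

/-! Let `Z_m(v)` be the size of the `m`-th generation below `v`. With `m = ⌊R_r⌋`, a ball of radius
`R_r` around `x` contains that generation below `x`. Conversely it is covered by `(m + 1) ^ 2`
generations of depth at most `m` below ancestors of `x` (`vol_le_of_forall_genSize_le`). Up to a
polynomial factor, it thus suffices to control `Z_m(v)` uniformly over vertices of depth at most
`r`.

Both deviations `Z_m ≥ b ^ m` with `b` above the mean and `Z_m ≤ b ^ m` with `b` below it have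
probability at most `exp (a - β ρ ^ m)` for some `β > 0` and `ρ > 1` (`decaysFast_ge`,
`decaysFast_le`). For the lower one it is essential that every vertex has at least two children. The
expected number of vertices up to depth `l ^ m` is only `exp (O(l ^ m))`, so for `1 < l < ρ` a union
bound and Borel–Cantelli exclude all deviations up to that depth for large `m`. Finally `R_r / log r
→ ∞` gives `r ≤ l ^ m`. Since Borel–Cantelli runs over the integer `m`, real `r` needs no extra
care. -/

namespace GaltonWatson

/-! ### Generations, distances and ball volumes in the tree -/

/-- The labels of the descendants of `v` which are `m` generations below `v`. -/
def descendants (c : List ℕ → ℕ) : ℕ → List ℕ → Finset (List ℕ)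
  | 0, v => {v}
  | m + 1, v => (Finset.range (c v)).biUnion fun i => descendants c m (i :: v)

/-- The number of descendants `m` generations below `v`. -/
def genSize (c : List ℕ → ℕ) : ℕ → List ℕ → ℕ
  | 0, _ => 1
  | m + 1, v => ∑ i ∈ Finset.range (c v), genSize c m (i :: v)

theorem IsVertex.of_append {c : List ℕ → ℕ} {v : List ℕ} :
    ∀ {u : List ℕ}, IsVertex c (u ++ v) → IsVertex c v
  | [], h => h
  | _ :: _, h => IsVertex.of_append h.2

theorem IsVertex.drop {c : List ℕ → ℕ} {v : List ℕ} (h : IsVertex c v) (k : ℕ) :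
    IsVertex c (v.drop k) :=
  IsVertex.of_append (u := v.take k) (by rwa [List.take_append_drop])

theorem mem_descendants {c : List ℕ → ℕ} {m : ℕ} {v w : List ℕ} (hv : IsVertex c v) :
    w ∈ descendants c m v ↔ IsVertex c w ∧ ∃ u : List ℕ, u.length = m ∧ w = u ++ v := by
  induction m generalizing v w with
  | zero =>
    simp only [descendants, Finset.mem_singleton, List.length_eq_zero_iff]
    constructor
    · rintro rfl
      exact ⟨hv, [], rfl, rfl⟩
    · rintro ⟨-, u, rfl, rfl⟩
      rfl
  | succ m ih =>
    simp only [descendants, Finset.mem_biUnion, Finset.mem_range]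
    constructor
    · rintro ⟨i, hi, hw⟩
      obtain ⟨hw', u, rfl, rfl⟩ := (ih (v := i :: v) ⟨hi, hv⟩).1 hw
      exact ⟨hw', u ++ [i], by simp, by simp⟩
    · rintro ⟨hw, u, hu, rfl⟩
      obtain ⟨u, i, rfl⟩ := List.eq_nil_or_concat' u |>.resolve_left (by rintro rfl; simp at hu)
      simp only [List.append_assoc, List.cons_append, List.nil_append,
        List.length_append, List.length_cons, List.length_nil, zero_add,
        Nat.add_right_cancel_iff] at hw hu ⊢
      have hi : IsVertex c (i :: v) := hw.of_append
      exact ⟨i, hi.1, (ih hi).2 ⟨hw, u, hu, rfl⟩⟩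

theorem exists_append_of_mem_descendants {c : List ℕ → ℕ} {m : ℕ} {v w : List ℕ}
    (h : w ∈ descendants c m v) : ∃ u : List ℕ, u.length = m ∧ w = u ++ v := by
  induction m generalizing v with
  | zero => exact ⟨[], rfl, by simpa [descendants] using h⟩
  | succ m ih =>
    simp only [descendants, Finset.mem_biUnion] at h
    obtain ⟨i, -, h⟩ := h
    obtain ⟨u, rfl, rfl⟩ := ih h
    exact ⟨u ++ [i], by simp, by simp⟩

theorem card_descendants (c : List ℕ → ℕ) (m : ℕ) (v : List ℕ) :
    (descendants c m v).card = genSize c m v := by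
  induction m generalizing v with
  | zero => rfl
  | succ m ih =>
    rw [descendants, genSize, Finset.card_biUnion]
    · simp only [ih]
    · intro i _ j _ hij
      refine Finset.disjoint_left.2 fun w hi hj => hij ?_
      obtain ⟨u, hu, rfl⟩ := exists_append_of_mem_descendants hi
      obtain ⟨u', hu', h⟩ := exists_append_of_mem_descendants hj
      have := (List.append_inj h (hu.trans hu'.symm)).2
      simpa using this

theorem genSize_pos {c : List ℕ → ℕ} (hc : ∀ v, 1 ≤ c v) (m : ℕ) (v : List ℕ) :
    1 ≤ genSize c m v := by
  induction m generalizing v with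
  | zero => rfl
  | succ m ih =>
    rw [genSize]
    exact (ih (0 :: v)).trans (Finset.single_le_sum (f := fun i => genSize c m (i :: v))
      (fun _ _ => Nat.zero_le _) (Finset.mem_range.2 (hc v)))

theorem genSize_monotone {c : List ℕ → ℕ} (hc : ∀ v, 1 ≤ c v) (v : List ℕ) :
    Monotone fun m => genSize c m v := by
  refine monotone_nat_of_le_succ fun m => ?_
  induction m generalizing v with
  | zero => exact genSize_pos hc 1 v
  | succ m ih =>
    rw [genSize, genSize]
    exact Finset.sum_le_sum fun i _ => ih (i :: v)

theorem dist_le_of_eq_append {c : List ℕ → ℕ} {x : Vertex c} :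
    ∀ (u : List ℕ) (y : Vertex c), y.1 = u ++ x.1 → (tree c).dist x y ≤ u.length
  | [], y, h => by
    have : y = x := Subtype.ext h
    simp [this]
  | i :: u, y, h => by
    have hv : IsVertex c (i :: (u ++ x.1)) := by
      have := y.2
      rwa [h] at this
    let z : Vertex c := ⟨u ++ x.1, hv.2⟩
    have hz : (tree c).Adj z y := Or.inl ⟨i, h⟩
    calc (tree c).dist x y ≤ (tree c).dist x z + (tree c).dist z y :=
          (tree_connected c).dist_triangle
      _ ≤ u.length + 1 :=
          add_le_add (dist_le_of_eq_append u z rfl) (SimpleGraph.dist_eq_one_iff_adj.2 hz).le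

/-- A walk reduces to climbing `k` generations and then descending along `u`. A first step down to a
child either cancels against a later climb or, if `k = 0`, extends the descent. -/
theorem exists_eq_append_drop_of_walk {c : List ℕ → ℕ} {x y : Vertex c}
    (p : (tree c).Walk x y) :
    ∃ (k : ℕ) (u : List ℕ), k + u.length ≤ p.length ∧ y.1 = u ++ x.1.drop k := by
  induction p with
  | nil => exact ⟨0, [], by simp, by simp⟩
  | @cons x z y h p ih =>
    obtain ⟨k, u, hk, hy⟩ := ih
    rw [SimpleGraph.Walk.length_cons]
    rcases h with ⟨i, hi⟩ | ⟨i, hi⟩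
    · cases k with
      | zero => exact ⟨0, u ++ [i], by rw [List.length_append, List.length_singleton]; omega, by simp [hy, hi]⟩
      | succ k => exact ⟨k, u, by omega, by simp [hy, hi]⟩
    · exact ⟨k + 1, u, by omega, by simp [hy, hi]⟩

theorem exists_eq_append_drop {c : List ℕ → ℕ} (x y : Vertex c) :
    ∃ (k : ℕ) (u : List ℕ), k + u.length ≤ (tree c).dist x y ∧ y.1 = u ++ x.1.drop k := by
  obtain ⟨p, hp⟩ := (tree_connected c).exists_walk_length_eq_dist x y
  rw [← hp]
  exact exists_eq_append_drop_of_walk p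

theorem length_le_of_mem_ball_root {c : List ℕ → ℕ} {x : Vertex c} {r : ℝ}
    (hx : x ∈ ball c (root c) r) : (x.1.length : ℝ) ≤ r := by
  obtain ⟨k, u, hu, h⟩ := exists_eq_append_drop (root c) x
  have h' : x.1 = u := by simpa [root] using h
  rw [h']
  refine le_trans ?_ (show ((tree c).dist (root c) x : ℝ) ≤ r from hx)
  exact_mod_cast (Nat.le_add_left _ _).trans hu

theorem genSize_le_vol (c : List ℕ → ℕ) (x : Vertex c) {s : ℝ} (hs : 0 ≤ s) :
    genSize c ⌊s⌋₊ x.1 ≤ vol c x s := by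
  rw [← card_descendants, ← Set.ncard_coe_finset, vol,
    ← Set.ncard_image_of_injective _ Subtype.val_injective]
  refine Set.ncard_le_ncard ?_ ((ball_finite c x s).image _)
  intro w hw
  obtain ⟨hw, u, hu, rfl⟩ := (mem_descendants x.2).1 hw
  refine ⟨⟨_, hw⟩, ?_, rfl⟩
  have := dist_le_of_eq_append (x := x) u ⟨_, hw⟩ rfl
  exact (Nat.cast_le.2 (this.trans hu.le)).trans (Nat.floor_le hs)

/-- A point of the ball is fixed by its ancestor `x.1.drop k` and its place in a generation below
it, with both depths at most `⌊s⌋₊`. As there are no leaves, generation sizes increase with depth,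
so the deepest generation bounds them all. -/
theorem vol_le_of_forall_genSize_le {c : List ℕ → ℕ} (hc : ∀ v, 1 ≤ c v) (x : Vertex c) {s : ℝ}
    {b : ℕ} (hb : ∀ y, IsVertex c y → y.length ≤ x.1.length → genSize c ⌊s⌋₊ y ≤ b) :
    vol c x s ≤ (⌊s⌋₊ + 1) ^ 2 * b := by
  set m := ⌊s⌋₊
  let S : Finset (List ℕ) := (Finset.range (m + 1) ×ˢ Finset.range (m + 1)).biUnion
    fun p => descendants c p.2 (x.1.drop p.1)
  have hS : S.card ≤ (m + 1) ^ 2 * b := by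
    have : (m + 1) ^ 2 = (Finset.range (m + 1) ×ˢ Finset.range (m + 1)).card := by
      simp [sq]
    rw [this]
    refine Finset.card_biUnion_le_card_mul _ _ _ fun p hp => ?_
    simp only [Finset.mem_product, Finset.mem_range] at hp
    rw [card_descendants]
    exact (genSize_monotone hc _ (by omega : p.2 ≤ m)).trans
      (hb _ (x.2.drop _) (by simp))
  refine le_trans ?_ hS
  rw [← Set.ncard_coe_finset, vol, ← Set.ncard_image_of_injective _ Subtype.val_injective]
  refine Set.ncard_le_ncard ?_ S.finite_toSet
  rintro _ ⟨y, hy, rfl⟩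
  obtain ⟨k, u, hu, h⟩ := exists_eq_append_drop x y
  have hd : (tree c).dist x y ≤ m := Nat.le_floor hy
  simp only [S, Finset.coe_biUnion, Set.mem_iUnion, Finset.mem_coe]
  exact ⟨(k, u.length), by simp; omega, (mem_descendants (x.2.drop k)).2 ⟨y.2, u, rfl, h⟩⟩

/-! ### Independence of disjoint parts of the tree -/

open ProbabilityTheory ENNReal

/-- The σ-algebra generated by the offspring numbers of the labels in `S`. -/
@[reducible] noncomputable def sigmaOf (S : Set (List ℕ)) : MeasurableSpace (List ℕ → ℕ) :=
  ⨆ v ∈ S, MeasurableSpace.comap (fun c => c v) ⊤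

/-- The labels of all potential descendants of `v`, including `v`. -/
def subtree (v : List ℕ) : Set (List ℕ) := {w | v <:+ w}

theorem sigmaOf_mono {S T : Set (List ℕ)} (h : S ⊆ T) : sigmaOf S ≤ sigmaOf T :=
  biSup_mono h

theorem sigmaOf_le (S : Set (List ℕ)) : sigmaOf S ≤ MeasurableSpace.pi :=
  iSup₂_le fun v _ => (measurable_pi_apply v).comap_le

theorem measurable_eval_sigmaOf {S : Set (List ℕ)} {v : List ℕ} (hv : v ∈ S) :
    Measurable[sigmaOf S] fun c : List ℕ → ℕ => c v :=
  measurable_iff_comap_le.2 (le_iSup₂_of_le v hv le_rfl)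

theorem self_mem_subtree (v : List ℕ) : v ∈ subtree v := List.suffix_rfl

theorem subtree_cons_subset (i : ℕ) (v : List ℕ) : subtree (i :: v) ⊆ subtree v :=
  fun _ h => (List.suffix_cons i v).trans h

theorem disjoint_singleton_subtree_cons (i : ℕ) (v : List ℕ) :
    Disjoint {v} (subtree (i :: v)) := by
  rw [Set.disjoint_singleton_left]
  intro h
  have := List.IsSuffix.length_le h
  simp at this

theorem disjoint_subtree_cons {i j : ℕ} (h : i ≠ j) (v : List ℕ) :
    Disjoint (subtree (i :: v)) (subtree (j :: v)) := by
  refine Set.disjoint_left.2 fun w hi hj => h ?_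
  have := List.suffix_of_suffix_length_le hi hj (by simp)
  simpa using this.eq_of_length (by simp)

theorem measurable_sum_range {Ω : Type*} [MeasurableSpace Ω] {N : Ω → ℕ} {f : ℕ → Ω → ℕ}
    (hN : Measurable N) (hf : ∀ i, Measurable (f i)) :
    Measurable fun ω => ∑ i ∈ Finset.range (N ω), f i ω := by
  have h : Measurable fun p : ℕ × Ω => ∑ i ∈ Finset.range p.1, f i p.2 :=
    measurable_from_prod_countable_right fun n =>
      Finset.measurable_sum (Finset.range n) fun i _ => hf i
  exact h.comp (hN.prodMk measurable_id)

theorem measurable_genSize (m : ℕ) (v : List ℕ) :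
    Measurable[sigmaOf (subtree v)] fun c => genSize c m v := by
  induction m generalizing v with
  | zero => exact @measurable_const _ _ _ (_) _
  | succ m ih =>
    exact @measurable_sum_range _ (sigmaOf (subtree v)) _ _
      (measurable_eval_sigmaOf (self_mem_subtree v))
      fun i => (ih (i :: v)).mono (sigmaOf_mono (subtree_cons_subset i v)) le_rfl

/-! ### Generating functions and first-moment bounds -/

section GenerationSize

variable (ν : Measure ℕ)

/-- The probability generating function of the offspring law. -/
noncomputable def pgf (s : ℝ≥0∞) : ℝ≥0∞ := ∫⁻ k, s ^ k ∂ν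

theorem pgf_mono : Monotone (pgf ν) :=
  fun _ _ h => lintegral_mono fun _ => pow_le_pow_left' h _

theorem tsum_measure_lt : ∑' i : ℕ, ν {k | i < k} = ∫⁻ k, (k : ℝ≥0∞) ∂ν := by
  have h : ∀ k : ℕ, (k : ℝ≥0∞) = ∑' i : ℕ, Set.indicator {k | i < k} 1 k := by
    intro k
    rw [tsum_eq_sum (s := Finset.range k)]
    · rw [Finset.sum_congr rfl (g := fun _ => 1)]
      · simp
      · intro i hi
        simpa [Set.indicator_apply] using hi
    · intro i hi
      simpa [Set.indicator_apply] using hi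
  simp_rw [h]
  rw [lintegral_tsum fun i => (measurable_of_countable _).aemeasurable]
  refine tsum_congr fun i => ?_
  rw [lintegral_indicator_one MeasurableSet.of_discrete]

variable [IsProbabilityMeasure ν]

instance : IsProbabilityMeasure (law ν) := by unfold law; infer_instance

theorem indep_sigmaOf {S T : Set (List ℕ)} (h : Disjoint S T) :
    Indep (sigmaOf S) (sigmaOf T) (law ν) := by
  have hi : iIndepFun (fun (v : List ℕ) (c : List ℕ → ℕ) => c v) (law ν) :=
    iIndepFun_infinitePi (P := fun _ : List ℕ => ν) (X := fun _ k => k) fun _ => measurable_id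
  exact indep_iSup_of_disjoint (fun v => (measurable_pi_apply v).comap_le) hi h

theorem lintegral_mul_of_disjoint {S T : Set (List ℕ)} (h : Disjoint S T)
    {f g : (List ℕ → ℕ) → ℝ≥0∞} (hf : Measurable[sigmaOf S] f) (hg : Measurable[sigmaOf T] g) :
    ∫⁻ c, f c * g c ∂(law ν) = (∫⁻ c, f c ∂(law ν)) * ∫⁻ c, g c ∂(law ν) :=
  lintegral_mul_eq_lintegral_mul_lintegral_of_independent_measurableSpace
    (sigmaOf_le S) (sigmaOf_le T) (indep_sigmaOf ν h) hf hg

theorem map_eval_law (v : List ℕ) : (law ν).map (fun c => c v) = ν :=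
  (measurePreserving_eval_infinitePi (fun _ : List ℕ => ν) v).map_eq

theorem law_preimage_eval (v : List ℕ) (A : Set ℕ) : law ν {c | c v ∈ A} = ν A := by
  conv_rhs => rw [← map_eval_law ν v]
  rw [Measure.map_apply (measurable_pi_apply v) (MeasurableSet.of_discrete)]
  rfl

theorem lintegral_prod_subtree (v : List ℕ) {f : ℕ → (List ℕ → ℕ) → ℝ≥0∞}
    (hf : ∀ i, Measurable[sigmaOf (subtree (i :: v))] (f i)) (k : ℕ) :
    ∫⁻ c, ∏ i ∈ Finset.range k, f i c ∂(law ν)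
      = ∏ i ∈ Finset.range k, ∫⁻ c, f i c ∂(law ν) := by
  induction k with
  | zero => simp
  | succ k ih =>
    simp only [Finset.prod_range_succ]
    rw [← ih]
    refine lintegral_mul_of_disjoint ν (S := ⋃ i ∈ Finset.range k, subtree (i :: v)) ?_ ?_ (hf k)
    · simp only [Set.disjoint_iUnion_left, Finset.mem_range]
      exact fun i hi => disjoint_subtree_cons hi.ne v
    · exact @Finset.measurable_prod _ _ _ _ _ _ (_) _ (Finset.range k) fun i hi => (hf i).mono
        (sigmaOf_mono (Set.subset_biUnion_of_mem (u := fun i => subtree (i :: v)) hi)) le_rfl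

/-- Branching property: given `c v = k`, the generation below `v` is a sum over `k` independent
subtrees, each with the transform of one generation less. -/
theorem lintegral_pow_genSize (s : ℝ≥0∞) (m : ℕ) (v : List ℕ) :
    ∫⁻ c, s ^ genSize c m v ∂(law ν) = (pgf ν)^[m] s := by
  induction m generalizing v with
  | zero => simp [genSize]
  | succ m ih =>
    have hmeas : ∀ i, Measurable[sigmaOf (subtree (i :: v))] fun c => s ^ genSize c m (i :: v) :=
      fun i => (measurable_of_countable fun k : ℕ => s ^ k).comp (measurable_genSize m (i :: v))
    have hmeas' : ∀ k, Measurable[sigmaOf (⋃ i, subtree (i :: v))]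
        fun c => ∏ i ∈ Finset.range k, s ^ genSize c m (i :: v) := fun k =>
      @Finset.measurable_prod _ _ _ _ _ _ (_) _ (Finset.range k) fun i _ => (hmeas i).mono
        (sigmaOf_mono (Set.subset_iUnion (fun i => subtree (i :: v)) i)) le_rfl
    have hind : ∀ k, Measurable[sigmaOf {v}]
        fun c : List ℕ → ℕ => Set.indicator {k} (fun _ => (1 : ℝ≥0∞)) (c v) := fun k =>
      (measurable_of_countable (Set.indicator {k} fun _ => (1 : ℝ≥0∞))).comp
        (measurable_eval_sigmaOf (Set.mem_singleton v))
    -- Splitting over the value of `c v` replaces a random number of factors by a fixed one, so that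
    -- independence applies term by term.
    have hsum : ∀ c : List ℕ → ℕ, s ^ genSize c (m + 1) v
        = ∑' k, Set.indicator {k} (fun _ => (1 : ℝ≥0∞)) (c v)
          * ∏ i ∈ Finset.range k, s ^ genSize c m (i :: v) := by
      intro c
      rw [tsum_eq_single (c v), genSize, Finset.prod_pow_eq_pow_sum]
      · simp
      · intro k hk
        simp [Set.indicator_of_notMem (show c v ∉ ({k} : Set ℕ) from fun h => hk h.symm)]
    simp only [hsum]
    have hterm : ∀ k, AEMeasurable (fun c => Set.indicator {k} (fun _ => (1 : ℝ≥0∞)) (c v)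
        * ∏ i ∈ Finset.range k, s ^ genSize c m (i :: v)) (law ν) := fun k =>
      (((hind k).mono (sigmaOf_le _) le_rfl).mul
        ((hmeas' k).mono (sigmaOf_le _) le_rfl)).aemeasurable
    rw [lintegral_tsum hterm, Function.iterate_succ_apply', pgf,
      lintegral_countable']
    refine tsum_congr fun k => ?_
    have hdisj : Disjoint {v} (⋃ i, subtree (i :: v)) := by
      simp only [Set.disjoint_iUnion_right]
      exact fun i => disjoint_singleton_subtree_cons i v
    rw [lintegral_mul_of_disjoint ν hdisj (hind k) (hmeas' k), lintegral_prod_subtree ν v hmeas]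
    simp only [ih, Finset.prod_const, Finset.card_range]
    rw [mul_comm]
    congr 1
    have : (fun c : List ℕ → ℕ => Set.indicator {k} (fun _ => (1 : ℝ≥0∞)) (c v))
        = Set.indicator {c | c v ∈ ({k} : Set ℕ)} 1 := by
      ext c; simp [Set.indicator_apply]
    have hk : MeasurableSet {c : List ℕ → ℕ | c v ∈ ({k} : Set ℕ)} :=
      measurable_pi_apply v (MeasurableSet.of_discrete (s := {k}))
    rw [this]
    exact (lintegral_indicator_one hk).trans (law_preimage_eval ν v {k})

/-- The event that some vertex `j` generations below `v` satisfies `A`. -/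
def reach (A : List ℕ → Set (List ℕ → ℕ)) : ℕ → List ℕ → Set (List ℕ → ℕ)
  | 0, v => A v
  | j + 1, v => ⋃ i, {c | i < c v} ∩ reach A j (i :: v)

theorem mem_reach {A : List ℕ → Set (List ℕ → ℕ)} {c : List ℕ → ℕ} (u v : List ℕ)
    (h : IsVertex c (u ++ v)) (hA : c ∈ A (u ++ v)) : c ∈ reach A u.length v := by
  induction u using List.reverseRecOn generalizing v with
  | nil => exact hA
  | append_singleton u i ih =>
    simp only [List.append_assoc, List.cons_append, List.nil_append] at h hA
    rw [List.length_append, List.length_singleton]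
    exact Set.mem_iUnion.2 ⟨i, h.of_append.1, ih _ h hA⟩

theorem measurableSet_reach {A : List ℕ → Set (List ℕ → ℕ)}
    (hA : ∀ v, MeasurableSet[sigmaOf (subtree v)] (A v)) (j : ℕ) (v : List ℕ) :
    MeasurableSet[sigmaOf (subtree v)] (reach A j v) := by
  induction j generalizing v with
  | zero => exact hA v
  | succ j ih =>
    refine @MeasurableSet.iUnion _ _ (_) _ _ fun i => @MeasurableSet.inter _ (_) _ _ ?_ ?_
    · exact measurable_eval_sigmaOf (self_mem_subtree v) (MeasurableSet.of_discrete (s := {k | i < k}))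
    · exact sigmaOf_mono (subtree_cons_subset i v) _ (ih (i :: v))

/-- Union bound over the children: `i < c v` is independent of the subtree of `i :: v`, and the
probabilities of `i < c v` sum to the mean offspring number. -/
theorem law_reach_le {A : List ℕ → Set (List ℕ → ℕ)}
    (hA : ∀ v, MeasurableSet[sigmaOf (subtree v)] (A v)) {p : ℝ≥0∞} (hp : ∀ v, law ν (A v) ≤ p)
    (j : ℕ) (v : List ℕ) : law ν (reach A j v) ≤ (∫⁻ k, (k : ℝ≥0∞) ∂ν) ^ j * p := by
  induction j generalizing v with
  | zero => simpa [reach] using hp v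
  | succ j ih =>
    calc law ν (reach A (j + 1) v)
        ≤ ∑' i, law ν ({c | i < c v} ∩ reach A j (i :: v)) := measure_iUnion_le _
      _ = ∑' i, law ν {c | i < c v} * law ν (reach A j (i :: v)) := by
          refine tsum_congr fun i => ?_
          refine (Indep_iff _ _ _).1
            (indep_sigmaOf ν (disjoint_singleton_subtree_cons i v)) _ _ ?_
            (measurableSet_reach hA j (i :: v))
          exact measurable_eval_sigmaOf (Set.mem_singleton v)
            (MeasurableSet.of_discrete (s := {k | i < k}))
      _ ≤ ∑' i, ν {k | i < k} * ((∫⁻ k, (k : ℝ≥0∞) ∂ν) ^ j * p) :=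
          ENNReal.tsum_le_tsum fun i =>
            mul_le_mul' (law_preimage_eval ν v {k | i < k}).le (ih (i :: v))
      _ = _ := by rw [ENNReal.tsum_mul_right, tsum_measure_lt, pow_succ']; ring

end GenerationSize

/-! ### Exponential moments and tails of generation sizes -/

section Tails

variable (ν : Measure ℕ)

theorem pgf_exp {t : ℝ} (ht : Integrable (fun k : ℕ => Real.exp (t * k)) ν) :
    pgf ν (ENNReal.ofReal (Real.exp t)) = ENNReal.ofReal (mgf (fun k : ℕ => (k : ℝ)) ν t) := by
  rw [mgf, ofReal_integral_eq_lintegral_ofReal ht (.of_forall fun _ => (Real.exp_pos _).le), pgf]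
  refine lintegral_congr fun k => ?_
  rw [← ENNReal.ofReal_pow (Real.exp_pos _).le, ← Real.exp_nat_mul, mul_comm]

/-- The offspring law has some finite exponential moment. -/
def HasExpMoment : Prop := ∃ a : ℝ, 0 < a ∧ Integrable (fun k : ℕ => Real.exp (a * k)) ν

variable {ν}

theorem HasExpMoment.exists_forall_integrable [IsFiniteMeasure ν] (h : HasExpMoment ν) :
    ∃ a : ℝ, 0 < a ∧ ∀ t ≤ a, Integrable (fun k : ℕ => Real.exp (t * k)) ν := by
  obtain ⟨a, ha, hint⟩ := h
  refine ⟨a, ha, fun t ht => hint.mono' (measurable_of_countable _).aestronglyMeasurable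
    (.of_forall fun k => ?_)⟩
  rw [Real.norm_of_nonneg (Real.exp_pos _).le]
  gcongr

theorem HasExpMoment.zero_mem_interior [IsFiniteMeasure ν] (h : HasExpMoment ν) :
    (0 : ℝ) ∈ interior (integrableExpSet (fun k : ℕ => (k : ℝ)) ν) := by
  obtain ⟨a, ha, hint⟩ := h.exists_forall_integrable
  rw [mem_interior_iff_mem_nhds]
  filter_upwards [Iio_mem_nhds ha] with t ht
  exact hint t (le_of_lt ht)

theorem HasExpMoment.integrable [IsFiniteMeasure ν] (h : HasExpMoment ν) :
    Integrable (fun k : ℕ => (k : ℝ)) ν := by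
  simpa using integrable_pow_of_mem_interior_integrableExpSet h.zero_mem_interior 1

theorem HasExpMoment.lintegral_eq [IsFiniteMeasure ν] (h : HasExpMoment ν) :
    ∫⁻ k, (k : ℝ≥0∞) ∂ν = ENNReal.ofReal (mean ν) := by
  rw [mean, ofReal_integral_eq_lintegral_ofReal h.integrable (.of_forall fun _ => by positivity)]
  simp

/-- The sign `σ = ±1` serves the upper and the lower tail. Since `1 ≤ b`, all intermediate arguments
`b ^ k * t` stay below `δ`. -/
theorem iterate_pgf_exp_le {b δ σ : ℝ} (hb : 1 ≤ b)
    (h : ∀ t, 0 ≤ t → t ≤ δ →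
      pgf ν (ENNReal.ofReal (Real.exp (σ * t))) ≤ ENNReal.ofReal (Real.exp (σ * (b * t))))
    (m : ℕ) {t : ℝ} (ht : 0 ≤ t) (htm : b ^ m * t ≤ δ) :
    (pgf ν)^[m] (ENNReal.ofReal (Real.exp (σ * t)))
      ≤ ENNReal.ofReal (Real.exp (σ * (b ^ m * t))) := by
  induction m with
  | zero => simp
  | succ m ih =>
    have hle : b ^ m * t ≤ b ^ (m + 1) * t := by
      gcongr
      omega
    rw [Function.iterate_succ_apply']
    refine (pgf_mono ν (ih (hle.trans htm))).trans ((h _ (by positivity) (hle.trans htm)).trans ?_)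
    rw [pow_succ', mul_assoc]

variable [IsProbabilityMeasure ν]

theorem HasExpMoment.hasDerivAt_mgf_sub_exp (h : HasExpMoment ν) (b : ℝ) :
    HasDerivAt (fun t => mgf (fun k : ℕ => (k : ℝ)) ν t - Real.exp (b * t)) (mean ν - b) 0 := by
  have h1 := hasDerivAt_mgf h.zero_mem_interior
  simp only [zero_mul, Real.exp_zero, mul_one] at h1
  have h2 : HasDerivAt (fun t => Real.exp (b * t)) b 0 := by
    simpa using ((hasDerivAt_id (0 : ℝ)).const_mul b).exp
  exact h1.sub h2

/-- The moment generating function and `exp (b * t)` agree at `0`, where their slopes are `mean ν`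
and `b`; hence the order just to the right of `0`. -/
theorem HasExpMoment.pgf_exp_le (h : HasExpMoment ν) {b : ℝ} (hb : mean ν < b) :
    ∃ δ > 0, ∀ t, 0 ≤ t → t ≤ δ →
      pgf ν (ENNReal.ofReal (Real.exp t)) ≤ ENNReal.ofReal (Real.exp (b * t)) := by
  obtain ⟨a, ha, hint⟩ := h.exists_forall_integrable
  have hs := hasDerivAt_iff_tendsto_slope.1 (h.hasDerivAt_mgf_sub_exp b)
  have hev := (hs.eventually (gt_mem_nhds (sub_neg.2 hb))).filter_mono
    (nhdsWithin_mono 0 (show Set.Ioi (0 : ℝ) ⊆ {0}ᶜ from fun x hx => ne_of_gt hx))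
  obtain ⟨u, hu, hsub⟩ := (mem_nhdsGT_iff_exists_Ioc_subset).1 hev
  refine ⟨min a u, lt_min ha hu, fun t ht0 ht => ?_⟩
  rw [pgf_exp ν (hint t (ht.trans (min_le_left _ _)))]
  refine ENNReal.ofReal_le_ofReal ?_
  rcases ht0.eq_or_lt with rfl | ht0
  · simp
  · have : slope (fun t => mgf (fun k : ℕ => (k : ℝ)) ν t - Real.exp (b * t)) 0 t
        < 0 := hsub ⟨ht0, ht.trans (min_le_right _ _)⟩
    rw [slope_def_field] at this
    simp only [mgf_zero, mul_zero, Real.exp_zero, sub_self, sub_zero, div_neg_iff] at this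
    rcases this with h' | h' <;> linarith

theorem HasExpMoment.pgf_exp_neg_le (h : HasExpMoment ν) {b : ℝ} (hb : b < mean ν) :
    ∃ δ > 0, ∀ t, 0 ≤ t → t ≤ δ →
      pgf ν (ENNReal.ofReal (Real.exp (-t))) ≤ ENNReal.ofReal (Real.exp (-(b * t))) := by
  obtain ⟨a, ha, hint⟩ := h.exists_forall_integrable
  have hs := hasDerivAt_iff_tendsto_slope.1 (h.hasDerivAt_mgf_sub_exp b)
  have hev := (hs.eventually (lt_mem_nhds (sub_pos.2 hb))).filter_mono
    (nhdsWithin_mono 0 (show Set.Iio (0 : ℝ) ⊆ {0}ᶜ from fun x hx => ne_of_lt hx))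
  obtain ⟨u, hu, hsub⟩ := (mem_nhdsLT_iff_exists_Ico_subset).1 hev
  have hu : u < 0 := hu
  refine ⟨-u, neg_pos.2 hu, fun t ht0 ht => ?_⟩
  rw [pgf_exp ν (hint (-t) (by linarith))]
  refine ENNReal.ofReal_le_ofReal ?_
  rcases ht0.eq_or_lt with rfl | ht0
  · simp
  · have : 0 < slope (fun t => mgf (fun k : ℕ => (k : ℝ)) ν t - Real.exp (b * t))
        0 (-t) := hsub ⟨by linarith, neg_lt_zero.2 ht0⟩
    rw [slope_def_field] at this
    simp only [mgf_zero, mul_zero, Real.exp_zero, sub_self, sub_zero, _root_.div_pos_iff,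
      mul_neg] at this
    rcases this with h' | h' <;> linarith

theorem pgf_le_sq (h2 : ∀ᵐ k ∂ν, 2 ≤ k) {s : ℝ≥0∞} (hs : s ≤ 1) : pgf ν s ≤ s ^ 2 := by
  calc pgf ν s ≤ ∫⁻ _, s ^ 2 ∂ν := by
        refine lintegral_mono_ae ?_
        filter_upwards [h2] with k hk
        exact pow_le_pow_right_of_le_one' hs hk
    _ = s ^ 2 := by simp

theorem iterate_pgf_le_pow (h2 : ∀ᵐ k ∂ν, 2 ≤ k) {s : ℝ≥0∞} (hs : s ≤ 1) (j : ℕ) :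
    (pgf ν)^[j] s ≤ s ^ 2 ^ j := by
  induction j with
  | zero => simp
  | succ j ih =>
    rw [Function.iterate_succ_apply', pow_succ, pow_mul]
    exact (pgf_le_sq h2 (ih.trans (pow_le_one' hs _))).trans (pow_le_pow_left' ih 2)

theorem law_chernoff (t L : ℝ) (m : ℕ) (v : List ℕ) :
    law ν {c | t * L ≤ t * genSize c m v}
      ≤ ENNReal.ofReal (Real.exp (-(t * L))) * (pgf ν)^[m] (ENNReal.ofReal (Real.exp t)) := by
  have hmeas : Measurable fun c => ENNReal.ofReal (Real.exp t) ^ genSize c m v :=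
    (measurable_of_countable fun k : ℕ => ENNReal.ofReal (Real.exp t) ^ k).comp
      ((measurable_genSize m v).mono (sigmaOf_le _) le_rfl)
  have h := mul_meas_ge_le_lintegral (μ := law ν) hmeas (ENNReal.ofReal (Real.exp (t * L)))
  rw [lintegral_pow_genSize] at h
  have hset : {c : List ℕ → ℕ | t * L ≤ t * genSize c m v} = {c | ENNReal.ofReal (Real.exp (t * L))
      ≤ ENNReal.ofReal (Real.exp t) ^ genSize c m v} := by
    ext c
    rw [Set.mem_ofPred_eq, Set.mem_ofPred_eq, ← ENNReal.ofReal_pow (Real.exp_pos _).le,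
      ← Real.exp_nat_mul, ENNReal.ofReal_le_ofReal_iff (Real.exp_pos _).le, Real.exp_le_exp,
      mul_comm (genSize c m v : ℝ)]
  rw [hset]
  refine le_trans (le_of_eq ?_) (mul_le_mul_right h _)
  rw [← mul_assoc, ← ENNReal.ofReal_mul (Real.exp_pos _).le, ← Real.exp_add]
  simp

/-- Super-exponential decay in the generation, uniformly in the vertex. -/
def DecaysFast (ν : Measure ℕ) (A : ℕ → List ℕ → Set (List ℕ → ℕ)) : Prop :=
  ∃ a b ρ : ℝ, 0 < b ∧ 1 < ρ ∧
    ∀ m v, law ν (A m v) ≤ ENNReal.ofReal (Real.exp (a - b * ρ ^ m))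

theorem HasExpMoment.decaysFast_ge (h : HasExpMoment ν) (hm : 1 < mean ν) {b : ℝ}
    (hb : mean ν < b) : DecaysFast ν fun m v => {c | b ^ m ≤ genSize c m v} := by
  obtain ⟨b', hb', hb'b⟩ := exists_between hb
  obtain ⟨δ, hδ, hpgf⟩ := h.pgf_exp_le hb'
  have hb1 : 1 < b' := hm.trans hb'
  have hb0 : 0 < b' := one_pos.trans hb1
  -- The largest admissible tilt `t = δ / b' ^ m` turns the Chernoff exponent into `δ - δ * (b / b')
  -- ^ m`.
  refine ⟨δ, δ, b / b', hδ, (one_lt_div hb0).2 hb'b, fun m v => ?_⟩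
  have ht : 0 < δ / b' ^ m := by positivity
  have hset : {c : List ℕ → ℕ | b ^ m ≤ genSize c m v}
      = {c | δ / b' ^ m * b ^ m ≤ δ / b' ^ m * genSize c m v} := by
    ext c; simp only [Set.mem_ofPred_eq, mul_le_mul_iff_right₀ ht]
  have hit := iterate_pgf_exp_le (σ := 1) hb1.le (by simpa using hpgf) m ht.le
    (by rw [mul_div_cancel₀ _ (by positivity)])
  rw [one_mul, one_mul, mul_div_cancel₀ _ (by positivity)] at hit
  refine (congrArg (law ν) hset).le.trans ((law_chernoff _ _ m v).trans ((mul_le_mul_right hit _).trans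
    (le_of_eq ?_)))
  rw [← ENNReal.ofReal_mul (Real.exp_pos _).le, ← Real.exp_add, div_pow]
  congr 2
  ring

/-- The first `j = m / N` generations produce at least `2 ^ j` independent subtrees. Each has
transform at most `exp (-δ)` after the other `m - j` generations, which gives `exp (-(δ * 2 ^ j))`.
-/
theorem HasExpMoment.decaysFast_le (h : HasExpMoment ν) (h2 : ∀ᵐ k ∂ν, 2 ≤ k)
    (hm : 1 < mean ν) {b : ℝ} (hb0 : 0 < b) (hb : b < mean ν) :
    DecaysFast ν fun m v => {c | (genSize c m v : ℝ) ≤ b ^ m} := by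
  obtain ⟨b', hb', hb'm⟩ := exists_between (max_lt hb hm)
  obtain ⟨hbb', hb1⟩ := max_lt_iff.1 hb'
  have hb'0 : 0 < b' := one_pos.trans hb1
  obtain ⟨δ, hδ, hpgf⟩ := h.pgf_exp_neg_le hb'm
  -- With `b' < (b' / b) ^ N`, growth at rate `b'` over `m - m / N` generations still exceeds `b ^
  -- m`, so `m / N` generations can be spent on binary branching.
  obtain ⟨N, hN⟩ := pow_unbounded_of_one_lt b' ((one_lt_div hb0).2 hbb')
  have hN0 : N ≠ 0 := by
    rintro rfl
    rw [pow_zero] at hN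
    linarith
  have hρ1 : (1 : ℝ) < 2 ^ ((N : ℝ)⁻¹) := Real.one_lt_rpow one_lt_two (by positivity)
  have hρN : ((2 : ℝ) ^ ((N : ℝ)⁻¹)) ^ N = 2 := Real.rpow_inv_natCast_pow two_pos.le hN0
  set ρ : ℝ := 2 ^ ((N : ℝ)⁻¹)
  refine ⟨δ, δ / 2, ρ, by positivity, hρ1, fun m v => ?_⟩
  set j := m / N
  have hjm : j ≤ m := Nat.div_le_self m N
  have hNj : N * j ≤ m := Nat.mul_div_le m N
  have hmN : m ≤ N * (j + 1) := (Nat.lt_mul_div_succ m (Nat.pos_of_ne_zero hN0)).le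
  set t := δ / b' ^ (m - j)
  have ht : 0 < t := by positivity
  have hbt : b' ^ (m - j) * t = δ := mul_div_cancel₀ _ (by positivity)
  have hset : {c : List ℕ → ℕ | (genSize c m v : ℝ) ≤ b ^ m}
      = {c | -t * b ^ m ≤ -t * genSize c m v} := by
    ext c; simp only [Set.mem_ofPred_eq, neg_mul, neg_le_neg_iff, mul_le_mul_iff_right₀ ht]
  have hit := iterate_pgf_exp_le (σ := -1) hb1.le (by simpa using hpgf) (m - j) ht.le hbt.le
  rw [hbt, neg_one_mul, neg_one_mul] at hit
  have hit' : (pgf ν)^[m] (ENNReal.ofReal (Real.exp (-t)))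
      ≤ ENNReal.ofReal (Real.exp (-(δ * 2 ^ j))) := by
    -- The outer `j` iterates are the generations nearest to `v` and are bounded by squaring; the
    -- inner `m - j` use the linearised estimate.
    conv_lhs => rw [← Nat.add_sub_of_le hjm, Function.iterate_add_apply]
    refine ((pgf_mono ν).iterate j hit).trans
      ((iterate_pgf_le_pow h2 ?_ j).trans (le_of_eq ?_))
    · rw [ENNReal.ofReal_le_one, Real.exp_le_one_iff]
      linarith
    · rw [← ENNReal.ofReal_pow (Real.exp_pos _).le, ← Real.exp_nat_mul]
      push_cast
      congr 2
      ring
  refine (congrArg (law ν) hset).le.trans ((law_chernoff _ _ m v).trans ((mul_le_mul_right hit' _).trans ?_))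
  rw [← ENNReal.ofReal_mul (Real.exp_pos _).le, ← Real.exp_add]
  refine ENNReal.ofReal_le_ofReal (Real.exp_le_exp.2 ?_)
  have h1 : t * b ^ m ≤ δ := by
    have : b' ^ j ≤ (b' / b) ^ m := by
      calc b' ^ j ≤ ((b' / b) ^ N) ^ j := by gcongr
        _ = (b' / b) ^ (N * j) := (pow_mul _ _ _).symm
        _ ≤ (b' / b) ^ m := pow_le_pow_right₀ ((one_lt_div hb0).2 hbb').le hNj
    rw [div_pow, le_div_iff₀ (by positivity)] at this
    rw [div_mul_eq_mul_div, div_le_iff₀ (by positivity)]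
    refine mul_le_mul_of_nonneg_left (le_of_mul_le_mul_left ?_ (pow_pos hb'0 j)) hδ.le
    rwa [← pow_add, Nat.add_sub_of_le hjm]
  have h3 : ρ ^ m ≤ 2 * 2 ^ j := by
    calc ρ ^ m ≤ ρ ^ (N * (j + 1)) := pow_le_pow_right₀ hρ1.le hmN
      _ = 2 * 2 ^ j := by rw [pow_mul, hρN, pow_succ']
  have h4 := mul_le_mul_of_nonneg_left h3 hδ.le
  linarith

/-! ### Borel–Cantelli over exponentially deep parts of the tree -/

theorem summable_exp_sub_pow {l ρ b : ℝ} (hl : 0 ≤ l) (hlρ : l < ρ) (hρ : 1 < ρ) (hb : 0 < b)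
    (a θ : ℝ) : Summable fun m : ℕ => Real.exp (θ * l ^ m + (a - b * ρ ^ m)) := by
  have h1 : (fun m : ℕ => θ * l ^ m + m) =o[atTop] fun m => ρ ^ m :=
    ((isLittleO_pow_pow_of_lt_left hl hlρ).const_mul_left θ).add
      (isLittleO_coe_const_pow_of_one_lt hρ)
  refine Summable.of_norm_bounded_eventually_nat
    (Real.summable_exp_neg_nat.mul_left (Real.exp a)) ?_
  filter_upwards [h1.bound hb] with m hm
  rw [Real.norm_of_nonneg (Real.exp_pos _).le, ← Real.exp_add, Real.exp_le_exp]
  rw [Real.norm_of_nonneg (by positivity : (0 : ℝ) ≤ ρ ^ m)] at hm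
  have := (le_abs_self _).trans hm
  linarith

/-- For `l < ρ` the decay `exp (-b * ρ ^ m)` beats the expected number of vertices up to depth `l ^
m`, so the probabilities of a bad vertex are summable. -/
theorem HasExpMoment.ae_eventually_notMem (h : HasExpMoment ν) (hm : 1 < mean ν)
    {A : ℕ → List ℕ → Set (List ℕ → ℕ)}
    (hA : ∀ m v, MeasurableSet[sigmaOf (subtree v)] (A m v)) (hd : DecaysFast ν A) :
    ∃ l : ℝ, 1 < l ∧ ∀ᵐ c ∂(law ν), ∀ᶠ m : ℕ in atTop,
      ∀ v, IsVertex c v → (v.length : ℝ) ≤ l ^ m → c ∉ A m v := by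
  obtain ⟨a, b, ρ, hb, hρ, hp⟩ := hd
  obtain ⟨l, hl1, hlρ⟩ := exists_between hρ
  refine ⟨l, hl1, ?_⟩
  set F : ℕ → Set (List ℕ → ℕ) := fun m => ⋃ j ∈ Finset.range (⌊l ^ m⌋₊ + 1), reach (A m) j []
  have hF : ∀ m, law ν (F m) ≤ ENNReal.ofReal
      (Real.exp ((1 + Real.log (mean ν)) * l ^ m + (a - b * ρ ^ m))) := by
    intro m
    set N := ⌊l ^ m⌋₊
    have hNl : (N : ℝ) ≤ l ^ m := Nat.floor_le (by positivity)
    have hm0 : 0 < mean ν := one_pos.trans hm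
    calc law ν (F m) ≤ ∑ j ∈ Finset.range (N + 1), law ν (reach (A m) j []) :=
          measure_biUnion_finset_le _ _
      _ ≤ ∑ j ∈ Finset.range (N + 1),
            ENNReal.ofReal (mean ν ^ N * Real.exp (a - b * ρ ^ m)) := by
          refine Finset.sum_le_sum fun j hj => (law_reach_le ν (hA m) (hp m) j []).trans ?_
          rw [h.lintegral_eq, ← ENNReal.ofReal_pow hm0.le, ← ENNReal.ofReal_mul (by positivity)]
          refine ENNReal.ofReal_le_ofReal (mul_le_mul_of_nonneg_right ?_ (Real.exp_pos _).le)
          exact pow_le_pow_right₀ hm.le (Nat.lt_succ_iff.1 (Finset.mem_range.1 hj))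
      _ = ENNReal.ofReal (((N : ℝ) + 1) * (mean ν ^ N * Real.exp (a - b * ρ ^ m))) := by
          rw [Finset.sum_const, Finset.card_range, nsmul_eq_mul,
            ENNReal.ofReal_mul (p := (N : ℝ) + 1) (by positivity), ← Nat.cast_succ,
            ENNReal.ofReal_natCast]
      _ ≤ _ := by
          refine ENNReal.ofReal_le_ofReal ?_
          have e1 : (N : ℝ) + 1 ≤ Real.exp (l ^ m) :=
            (add_le_add_left hNl 1).trans (Real.add_one_le_exp _)
          have e2 : mean ν ^ N ≤ Real.exp (Real.log (mean ν) * l ^ m) := by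
            calc mean ν ^ N = Real.exp (Real.log (mean ν) * N) := by
                  rw [mul_comm, Real.exp_nat_mul, Real.exp_log hm0]
              _ ≤ _ := Real.exp_le_exp.2 (mul_le_mul_of_nonneg_left hNl (Real.log_nonneg hm.le))
          calc _ ≤ Real.exp (l ^ m) * (Real.exp (Real.log (mean ν) * l ^ m)
                  * Real.exp (a - b * ρ ^ m)) := by gcongr
            _ = _ := by
              rw [← Real.exp_add, ← Real.exp_add]
              congr 1
              ring
  have hsum : ∑' m, law ν (F m) ≠ ⊤ :=
    ne_top_of_le_ne_top
      (summable_exp_sub_pow (one_pos.trans hl1).le hlρ hρ hb a _).tsum_ofReal_ne_top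
      (ENNReal.tsum_le_tsum hF)
  filter_upwards [MeasureTheory.ae_eventually_notMem hsum] with c hc
  filter_upwards [hc] with m hm v hv hlen hcA
  refine hm (Set.mem_biUnion (x := v.length) ?_ (mem_reach v [] (by simpa) (by simpa)))
  exact Finset.mem_coe.2 (Finset.mem_range.2 (Nat.lt_succ_of_le (Nat.le_floor hlen)))

/-- For a vertex label of length at most `l ^ m`, the `m`-th generation size is of order
`exp (m * growthRate)`, up to a factor `exp (m * ε)`. -/
theorem HasExpMoment.ae_genSize_bounds (h : HasExpMoment ν) (h2 : ∀ᵐ k ∂ν, 2 ≤ k)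
    (hm : 1 < mean ν) {ε : ℝ} (hε : 0 < ε) :
    ∃ l : ℝ, 1 < l ∧ ∀ᵐ c ∂(law ν), ∀ᶠ m : ℕ in atTop,
      ∀ v, IsVertex c v → (v.length : ℝ) ≤ l ^ m →
        Real.exp (m * (growthRate ν - ε)) ≤ genSize c m v ∧
          (genSize c m v : ℝ) ≤ Real.exp (m * (growthRate ν + ε)) := by
  have hm0 : 0 < mean ν := one_pos.trans hm
  have hlo : Real.exp (growthRate ν - ε) < mean ν := by
    rw [← Real.lt_log_iff_exp_lt hm0, growthRate]
    linarith
  have hup : mean ν < Real.exp (growthRate ν + ε) := by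
    rw [← Real.log_lt_iff_lt_exp hm0, growthRate]
    linarith
  have hmeas : ∀ (m : ℕ) (v : List ℕ) (S : Set ℕ),
      MeasurableSet[sigmaOf (subtree v)] {c | genSize c m v ∈ S} := fun m v S =>
    measurable_genSize m v (MeasurableSet.of_discrete (s := S))
  obtain ⟨l₁, hl₁, h₁⟩ := h.ae_eventually_notMem hm
    (fun m v => hmeas m v {k | (k : ℝ) ≤ Real.exp (growthRate ν - ε) ^ m})
    (h.decaysFast_le h2 hm (Real.exp_pos _) hlo)
  obtain ⟨l₂, hl₂, h₂⟩ := h.ae_eventually_notMem hm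
    (fun m v => hmeas m v {k | Real.exp (growthRate ν + ε) ^ m ≤ (k : ℝ)})
    (h.decaysFast_ge hm hup)
  refine ⟨min l₁ l₂, lt_min hl₁ hl₂, ?_⟩
  filter_upwards [h₁, h₂] with c hc₁ hc₂
  filter_upwards [hc₁, hc₂] with m hm₁ hm₂ v hv hlen
  have hmin : 0 ≤ min l₁ l₂ := (one_pos.trans (lt_min hl₁ hl₂)).le
  have k₁ := hm₁ v hv (hlen.trans (pow_le_pow_left₀ hmin (min_le_left _ _) m))
  have k₂ := hm₂ v hv (hlen.trans (pow_le_pow_left₀ hmin (min_le_right _ _) m))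
  simp only [not_le] at k₁ k₂
  rw [Real.exp_nat_mul, Real.exp_nat_mul]
  exact ⟨k₁.le, k₂.le⟩

end Tails

theorem ae_two_le_of_two_le_dMin {ν : Measure ℕ} (h : 2 ≤ dMin ν) : ∀ᵐ k ∂ν, 2 ≤ k := by
  filter_upwards [Measure.support_mem_ae (μ := ν)] with k hk
  exact h.trans (Nat.sInf_le hk)

theorem ae_forall_two_le {ν : Measure ℕ} [IsProbabilityMeasure ν] (h : ∀ᵐ k ∂ν, 2 ≤ k) :
    ∀ᵐ c ∂(law ν), ∀ v, 2 ≤ c v :=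
  ae_all_iff.2 fun v =>
    (measurePreserving_eval_infinitePi (fun _ : List ℕ => ν) v).quasiMeasurePreserving.ae h

/-! ### From generation sizes to volumes of radius `R r` -/

section Radius

variable {R : ℝ → ℝ}

theorem tendsto_atTop_of_div_log (hR : Tendsto (fun r => R r / Real.log r) atTop atTop) :
    Tendsto R atTop atTop := by
  refine (hR.atTop_mul_atTop₀ Real.tendsto_log_atTop).congr' ?_
  filter_upwards [eventually_gt_atTop 1] with r hr
  exact div_mul_cancel₀ _ (Real.log_pos hr).ne'

theorem eventually_le_pow_floor (hR : Tendsto (fun r => R r / Real.log r) atTop atTop) {l : ℝ}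
    (hl : 1 < l) : ∀ᶠ r in atTop, r ≤ l ^ ⌊R r⌋₊ := by
  -- The factor `2` pays for the floor: `R r ≥ 2` gives `⌊R r⌋₊ ≥ R r / 2`.
  filter_upwards [hR.eventually_ge_atTop (2 / Real.log l), eventually_gt_atTop 1,
    (tendsto_atTop_of_div_log hR).eventually_ge_atTop 2] with r h1 hr h2
  have hl0 := Real.log_pos hl
  rw [div_le_div_iff₀ hl0 (Real.log_pos hr)] at h1
  have hfl := Nat.lt_floor_add_one (R r)
  rw [← Real.log_le_log_iff (by linarith) (by positivity), Real.log_pow]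
  nlinarith

/-- Uniform control of generation sizes on exponentially large balls gives the growth rate of the
volume of balls whose centre may depend on the radius. -/
theorem tendsto_log_vol {c : List ℕ → ℕ} {θ : ℝ} (hc : ∀ v, 1 ≤ c v)
    (hsize : ∀ n : ℕ, ∃ l : ℝ, 1 < l ∧ ∀ᶠ m : ℕ in atTop,
      ∀ v, IsVertex c v → (v.length : ℝ) ≤ l ^ m →
        Real.exp (m * (θ - 1 / ((n : ℝ) + 1))) ≤ genSize c m v ∧
          (genSize c m v : ℝ) ≤ Real.exp (m * (θ + 1 / ((n : ℝ) + 1))))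
    (hR : Tendsto (fun r => R r / Real.log r) atTop atTop) {f : ℝ → ℕ}
    (hf : ∀ r, 0 ≤ r → ∃ x ∈ ball c (root c) r, f r = vol c x (R r)) :
    Tendsto (fun r => 1 / R r * Real.log (f r)) atTop (𝓝 θ) := by
  have hRtop := tendsto_atTop_of_div_log hR
  have hfloor : Tendsto (fun r => (⌊R r⌋₊ : ℝ) / R r) atTop (𝓝 1) :=
    tendsto_nat_floor_div_atTop.comp hRtop
  -- This is the contribution of the polynomial factor `(⌊R r⌋₊ + 1) ^ 2 ≤ (2 * R r) ^ 2`.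
  have hlog : Tendsto (fun r => 2 * (Real.log 2 / R r + Real.log (R r) / R r)) atTop (𝓝 0) := by
    have h1 : Tendsto (fun r => Real.log 2 / R r) atTop (𝓝 0) := hRtop.const_div_atTop _
    have h2 : Tendsto (fun r => Real.log (R r) / R r) atTop (𝓝 0) :=
      Real.isLittleO_log_id_atTop.tendsto_div_nhds_zero.comp hRtop
    simpa using (h1.add h2).const_mul 2
  have hbounds : ∀ n : ℕ, ∀ᶠ r in atTop,
      (⌊R r⌋₊ : ℝ) / R r * (θ - 1 / ((n : ℝ) + 1)) ≤ 1 / R r * Real.log (f r) ∧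
      1 / R r * Real.log (f r) ≤ 2 * (Real.log 2 / R r + Real.log (R r) / R r)
        + (⌊R r⌋₊ : ℝ) / R r * (θ + 1 / ((n : ℝ) + 1)) := by
    intro n
    obtain ⟨l, hl, hev⟩ := hsize n
    filter_upwards [(tendsto_nat_floor_atTop.comp hRtop).eventually hev,
      eventually_le_pow_floor hR hl, eventually_ge_atTop 0, hRtop.eventually_ge_atTop 1]
      with r hm hrl hr0 hR1
    simp only [Function.comp_apply] at hm
    have hR0 : 0 < R r := by linarith
    obtain ⟨x, hx, hfx⟩ := hf r hr0
    have hxl := (length_le_of_mem_ball_root hx).trans hrl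
    set m := ⌊R r⌋₊
    have hmR : (m : ℝ) ≤ R r := Nat.floor_le hR0.le
    have hlow : Real.exp (m * (θ - 1 / ((n : ℝ) + 1))) ≤ f r := by
      rw [hfx]
      exact (hm x.1 x.2 hxl).1.trans (Nat.cast_le.2 (genSize_le_vol c x hR0.le))
    have hup : (f r : ℝ) ≤ (2 * R r) ^ 2 * Real.exp (m * (θ + 1 / ((n : ℝ) + 1))) := by
      have h := vol_le_of_forall_genSize_le hc x (s := R r)
        (b := ⌊Real.exp (m * (θ + 1 / ((n : ℝ) + 1)))⌋₊) fun y hy hyx =>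
          Nat.le_floor (hm y hy ((Nat.cast_le.2 hyx).trans hxl)).2
      rw [← hfx] at h
      calc (f r : ℝ) ≤ ((m : ℝ) + 1) ^ 2 * (⌊Real.exp (m * (θ + 1 / ((n : ℝ) + 1)))⌋₊ : ℝ) := by
            exact_mod_cast h
        _ ≤ _ := by
            gcongr
            · linarith
            · exact Nat.floor_le (Real.exp_pos _).le
    have hf0 : (0 : ℝ) < f r := (Real.exp_pos _).trans_le hlow
    constructor
    · rw [one_div_mul_eq_div, div_mul_eq_mul_div]
      gcongr
      rwa [Real.le_log_iff_exp_le hf0]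
    · have h := Real.log_le_log hf0 hup
      rw [Real.log_mul (by positivity) (Real.exp_pos _).ne', Real.log_exp, Real.log_pow,
        Real.log_mul two_ne_zero hR0.ne'] at h
      rw [one_div_mul_eq_div, ← add_div, ← mul_div_assoc, div_mul_eq_mul_div, ← add_div]
      gcongr
      exact_mod_cast h
  rw [tendsto_order]
  constructor
  · intro a ha
    obtain ⟨n, hn⟩ := exists_nat_one_div_lt (sub_pos.2 ha)
    have ht := hfloor.mul_const (θ - 1 / ((n : ℝ) + 1))
    rw [one_mul] at ht
    filter_upwards [hbounds n, ht.eventually (lt_mem_nhds (by linarith : a < _))] with r h1 h2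
    exact h2.trans_le h1.1
  · intro a ha
    obtain ⟨n, hn⟩ := exists_nat_one_div_lt (sub_pos.2 ha)
    have ht := hlog.add (hfloor.mul_const (θ + 1 / ((n : ℝ) + 1)))
    rw [one_mul, zero_add] at ht
    filter_upwards [hbounds n, ht.eventually (gt_mem_nhds (by linarith : _ < a))] with r h1 h2
    exact h1.2.trans_lt h2

end Radius

theorem root_mem_ball (c : List ℕ → ℕ) {r : ℝ} (hr : 0 ≤ r) : root c ∈ ball c (root c) r := by
  simpa [ball] using hr

end GaltonWatson

/-! ### Conclusion -/

theorem lemma2p2 (ν : Measure ℕ) [IsProbabilityMeasure ν]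
    (hdmin : 2 ≤ GaltonWatson.dMin ν)
    (hmean : 2 < GaltonWatson.mean ν)
    (hexp : ∃ a : ℝ, 0 < a ∧ Integrable (fun k : ℕ => Real.exp (a * k)) ν)
    (R : ℝ → ℝ) (hR : Tendsto (fun r => R r / Real.log r) atTop atTop) :
    ∀ᵐ c ∂(GaltonWatson.law ν),
      Tendsto (fun r : ℝ => 1 / R r * Real.log
          ((⨅ x : GaltonWatson.ball c (GaltonWatson.root c) r,
            GaltonWatson.vol c x (R r) : ℕ) : ℝ))
        atTop (𝓝 (GaltonWatson.growthRate ν)) ∧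
      Tendsto (fun r : ℝ => 1 / R r * Real.log
          ((⨆ x : GaltonWatson.ball c (GaltonWatson.root c) r,
            GaltonWatson.vol c x (R r) : ℕ) : ℝ))
        atTop (𝓝 (GaltonWatson.growthRate ν)) := by
  have h : GaltonWatson.HasExpMoment ν := hexp
  have h2 := GaltonWatson.ae_two_le_of_two_le_dMin hdmin
  have hm : 1 < GaltonWatson.mean ν := by linarith
  -- Only the countably many errors `1 / (n + 1)` are used, so one null set suffices.
  choose l hl hae using fun n : ℕ =>
    h.ae_genSize_bounds h2 hm (Nat.one_div_pos_of_nat (α := ℝ) (n := n))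
  filter_upwards [GaltonWatson.ae_forall_two_le h2, ae_all_iff.2 hae] with c hc hsize
  have key := fun f => GaltonWatson.tendsto_log_vol (f := f)
    (fun v => one_le_two.trans (hc v)) (fun n => ⟨l n, hl n, hsize n⟩) hR
  have hfin : ∀ r, Finite (GaltonWatson.ball c (GaltonWatson.root c) r) := fun r =>
    (GaltonWatson.ball_finite c (GaltonWatson.root c) r).to_subtype
  -- The ball around the root is finite and nonempty, so infimum and supremum are attained; each is
  -- the volume around some centre depending on `r`.
  refine ⟨key _ fun r hr => ?_, key _ fun r hr => ?_⟩
  · have : Nonempty (GaltonWatson.ball c (GaltonWatson.root c) r) :=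
      ⟨⟨_, GaltonWatson.root_mem_ball c hr⟩⟩
    obtain ⟨x, hx⟩ := exists_eq_ciInf_of_finite
      (f := fun x : GaltonWatson.ball c (GaltonWatson.root c) r => GaltonWatson.vol c x (R r))
    exact ⟨x, x.2, hx.symm⟩
  · have : Nonempty (GaltonWatson.ball c (GaltonWatson.root c) r) :=
      ⟨⟨_, GaltonWatson.root_mem_ball c hr⟩⟩
    obtain ⟨x, hx⟩ := exists_eq_ciSup_of_finite
      (f := fun x : GaltonWatson.ball c (GaltonWatson.root c) r => GaltonWatson.vol c x (R r))
    exact ⟨x, x.2, hx.symm⟩
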